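/- For every real $\varepsilon>0$ there exists $N_0=N_0(\varepsilon)\in\mathbb N$ such that the following holds. Let $G$ be a bipartite multigraph (parallel edges are allowed, with no restriction on multiplicities) whose edges are coloured with $n\ge N_0$ colours. Suppose that the colouring is proper, i.e. any two distinct edges sharing a vertex receive different colours, and that each of the $n$ colours appears on at least $(1+\varepsilon)n$ edges. Then $G$ contains a rainbow matching using every colour, i.e. a set of pairwise vertex-disjoint edges containing exactly one edge of each of the $n$ colours. -/

import Mathlib

open scoped Graph

namespace Graph

variable {α β κ : Type*}

/-- A multigraph is bipartite if its vertex set splits into two disjoint parts such that every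
edge joins a vertex of one part to a vertex of the other (so there are no loops, while parallel
edges are allowed). -/
def IsBipartiteMultigraph (G : Graph α β) : Prop :=
  ∃ X Y : Set α, Disjoint X Y ∧ X ∪ Y = V(G) ∧
    ∀ e x y, G.IsLink e x y → (x ∈ X ∧ y ∈ Y) ∨ (x ∈ Y ∧ y ∈ X)

/-- An edge-colouring is proper if two distinct edges with a common endvertex
always receive different colours. In particular parallel edges receive different colours. -/
def IsProperEdgeColouring (G : Graph α β) (c : E(G) → κ) : Prop :=
  ∀ e f : E(G), e ≠ f → (∃ v, G.Inc e v ∧ G.Inc f v) → c e ≠ c f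

/-- A matching is a set of edges no two of which share an endvertex. -/
def IsMatchingSet (G : Graph α β) (M : Set E(G)) : Prop :=
  ∀ e ∈ M, ∀ f ∈ M, e ≠ f → ¬ ∃ v, G.Inc e v ∧ G.Inc f v

/-- A rainbow matching is a matching whose edges all have different colours. -/
def IsRainbowMatching (G : Graph α β) (c : E(G) → κ) (M : Set E(G)) : Prop :=
  G.IsMatchingSet M ∧ Set.InjOn c M

end Graph

/-! Trim every colour class to the same size `m`, about `(1 + ε) n`, and reserve sparse random
vertex sets `P` and `Q` on the two sides. Few edges of each colour meet `P` or `Q`, yet linearly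
many lie inside `P × Q` (`Finset.exists_sparse_sample`, a Chernoff and union bound).

The edges avoiding both sets still number at least `(1 + ε / 2) n` in each colour. A maximum rainbow
matching among them misses only a bounded number of colours, at most `2 / ε`: every unused colour
enlarges by `ε n / 2` the set of covered vertices reachable by alternating paths
(`IsRainbowAssignment.exists_reachable`), and at most `n` vertices are covered. The missing colours
are then placed greedily inside `P × Q`, which is disjoint from everything used so far. -/

/-! ### Sparse random vertex sets -/

open Finset in
/-- The generating function of the size of the intersection of `A` with a random subset of `V`
containing every element independently with probability `p`. -/
lemma Finset.sum_powerset_weight_mul_pow {X : Type*} [DecidableEq X] (V A : Finset X) (hA : A ⊆ V)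
    (p s : ℝ) :
    ∑ T ∈ V.powerset, p ^ #T * (1 - p) ^ #(V \ T) * s ^ #(A ∩ T) = (1 + p * (s - 1)) ^ #A := by
  have h := Finset.prod_add (fun i => p * (if i ∈ A then s else 1)) (fun _ => 1 - p) V
  have h1 : ∏ i ∈ V, (p * (if i ∈ A then s else 1) + (1 - p)) = (1 + p * (s - 1)) ^ #A := by
    rw [← Finset.prod_const, ← Finset.prod_subset hA]
    · refine Finset.prod_congr rfl fun i hi => ?_
      simp only [hi, if_true]; ring
    · intro i _ hi
      simp only [hi, if_false]; ring
  rw [← h1, h]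
  refine Finset.sum_congr rfl fun T _ => ?_
  rw [Finset.prod_mul_distrib, Finset.prod_const, Finset.prod_const, Finset.prod_ite]
  simp only [Finset.prod_const, one_pow, mul_one]
  rw [Finset.filter_mem_eq_inter, Finset.inter_comm]
  ring

/-- The union bound: at most `m` indices, each with two tails of size at most `exp (-(c * m))`. -/
lemma Real.eventually_two_mul_mul_exp_neg_lt_one {c : ℝ} (hc : 0 < c) :
    ∃ N : ℕ, ∀ m : ℕ, N ≤ m → (m : ℝ) * (2 * Real.exp (-(c * m))) < 1 := by
  have h1 := (Real.tendsto_pow_mul_exp_neg_atTop_nhds_zero 1).comp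
    ((tendsto_natCast_atTop_atTop (R := ℝ)).const_mul_atTop hc)
  have h2 := h1.eventually (gt_mem_nhds (show (0 : ℝ) < c / 2 by positivity))
  obtain ⟨N, hN⟩ := Filter.eventually_atTop.1 h2
  refine ⟨N, fun m hm => ?_⟩
  have := hN m hm
  simp only [Function.comp, pow_one] at this
  have h3 : c * ((m : ℝ) * (2 * Real.exp (-(c * m)))) < c * 1 := by linarith
  exact lt_of_mul_lt_mul_left h3 hc.le

open Finset in
/-- A sparse random set meets each of the sets `A j` in few elements and each of the sets `B j`
in linearly many elements. -/
lemma Finset.exists_sparse_sample {δ β : ℝ} (hδ : 0 < δ) (hδ1 : δ ≤ 1) (hβ : 0 < β) :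
    ∃ γ : ℝ, 0 < γ ∧ ∃ N : ℕ, ∀ m : ℕ, N ≤ m → ∀ (X J : Type*) [DecidableEq X] [Fintype J]
      (A B : J → Finset X), Fintype.card J ≤ m → (∀ j, #(A j) ≤ m) →
      (∀ j, β * m ≤ #(B j)) →
      ∃ T : Finset X, ∀ j, (#(A j ∩ T) : ℝ) ≤ δ * m ∧ γ * m ≤ #(B j ∩ T) := by
  -- As `e - 1 < 2`, this density gives `1 + p * (e - 1) ≤ exp (δ / 2)`, half of the exponent
  -- allowed by `δ * m`.
  set p : ℝ := δ / 4 with hp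
  have hp0 : 0 < p := by positivity
  have hp1 : p ≤ 1 := by linarith
  set c : ℝ := min (δ / 2) (p * β / 4) with hc
  have hc0 : 0 < c := by positivity
  obtain ⟨N, hN⟩ := Real.eventually_two_mul_mul_exp_neg_lt_one hc0
  refine ⟨p * β / 4, by positivity, N, fun m hm X J _ _ A B hJ hA hB => ?_⟩
  by_contra! hbad
  have hm0 : (0 : ℝ) ≤ m := Nat.cast_nonneg m
  let V : Finset X := univ.biUnion fun j => A j ∪ B j
  have hAV : ∀ j, A j ⊆ V := fun j x hx => mem_biUnion.2 ⟨j, mem_univ _, mem_union_left _ hx⟩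
  have hBV : ∀ j, B j ⊆ V := fun j x hx => mem_biUnion.2 ⟨j, mem_univ _, mem_union_right _ hx⟩
  let w : Finset X → ℝ := fun T => p ^ #T * (1 - p) ^ #(V \ T)
  have hw0 : ∀ T, 0 ≤ w T := fun T =>
    mul_nonneg (pow_nonneg hp0.le _) (pow_nonneg (by linarith) _)
  have hw1 : ∑ T ∈ V.powerset, w T = 1 := by
    simpa using sum_powerset_weight_mul_pow V ∅ (empty_subset _) p 1
  have hgen : ∀ C ⊆ V, ∀ s, ∑ T ∈ V.powerset, w T * s ^ #(C ∩ T) = (1 + p * (s - 1)) ^ #C :=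
    fun C hC s => sum_powerset_weight_mul_pow V C hC p s
  -- Exponential Markov bound: one summand is at least 1 whenever `T` violates the corresponding
  -- inequality for `j`. If every `T` were bad, the expected sum over `j` would be at least 1.
  let g : J → Finset X → ℝ := fun j T =>
    Real.exp (-(δ * m)) * Real.exp 1 ^ #(A j ∩ T) +
      Real.exp (p * β / 4 * m) * Real.exp (-1) ^ #(B j ∩ T)
  have hg : ∀ T, 1 ≤ ∑ j, g j T := by
    intro T
    obtain ⟨j, hj⟩ := hbad T
    refine le_trans ?_ (single_le_sum (f := fun j => g j T) (fun i _ => by positivity)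
      (mem_univ j))
    simp only [g, ← Real.exp_nat_mul, ← Real.exp_add]
    by_cases h : (#(A j ∩ T) : ℝ) ≤ δ * m
    · have := hj h
      have h1 := Real.one_le_exp (x := p * β / 4 * m + #(B j ∩ T) * -1) (by linarith)
      have h2 := Real.exp_pos (-(δ * m) + #(A j ∩ T) * 1)
      linarith
    · have h1 := Real.one_le_exp (x := -(δ * m) + #(A j ∩ T) * 1) (by linarith)
      have h2 := Real.exp_pos (p * β / 4 * m + #(B j ∩ T) * -1)
      linarith
  have hexpc : ∀ t, c ≤ t → Real.exp (-(t * m)) ≤ Real.exp (-(c * m)) := fun t ht =>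
    Real.exp_le_exp.2 (neg_le_neg (mul_le_mul_of_nonneg_right ht hm0))
  have hj : ∀ j, ∑ T ∈ V.powerset, w T * g j T ≤ 2 * Real.exp (-(c * m)) := by
    intro j
    have hsplit : ∑ T ∈ V.powerset, w T * g j T =
        Real.exp (-(δ * m)) * (1 + p * (Real.exp 1 - 1)) ^ #(A j) +
        Real.exp (p * β / 4 * m) * (1 + p * (Real.exp (-1) - 1)) ^ #(B j) := by
      rw [← hgen _ (hAV j), ← hgen _ (hBV j), mul_sum, mul_sum, ← sum_add_distrib]
      exact sum_congr rfl fun T _ => by simp only [g]; ring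
    have he := Real.exp_one_lt_d9
    have he1 := Real.exp_one_gt_d9
    have he2 : Real.exp (-1) ≤ 1 / 2 := by
      rw [Real.exp_neg, inv_eq_one_div]
      exact one_div_le_one_div_of_le (by norm_num) (by linarith)
    have hu : Real.exp (-(δ * m)) * (1 + p * (Real.exp 1 - 1)) ^ #(A j) ≤
        Real.exp (-(c * m)) := by
      have h1 : (1 + p * (Real.exp 1 - 1)) ≤ Real.exp (δ / 2) := by
        have := Real.add_one_le_exp (δ / 2)
        nlinarith
      have h2 : (1 + p * (Real.exp 1 - 1)) ^ #(A j) ≤ Real.exp (δ / 2 * m) := by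
        calc _ ≤ Real.exp (δ / 2) ^ #(A j) := pow_le_pow_left₀ (by nlinarith) h1 _
          _ ≤ Real.exp (δ / 2) ^ m := pow_le_pow_right₀ (Real.one_le_exp (by positivity)) (hA j)
          _ = _ := by rw [← Real.exp_nat_mul, mul_comm]
      calc _ ≤ Real.exp (-(δ * m)) * Real.exp (δ / 2 * m) := by gcongr
        _ = Real.exp (-(δ / 2 * m)) := by rw [← Real.exp_add]; congr 1; ring
        _ ≤ _ := hexpc _ (min_le_left _ _)
    have hl : Real.exp (p * β / 4 * m) * (1 + p * (Real.exp (-1) - 1)) ^ #(B j) ≤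
        Real.exp (-(c * m)) := by
      have h1 : (1 + p * (Real.exp (-1) - 1)) ≤ Real.exp (-(p / 2)) := by
        have := Real.add_one_le_exp (-(p / 2))
        nlinarith
      have h2 : (1 + p * (Real.exp (-1) - 1)) ^ #(B j) ≤ Real.exp (-(p / 2 * (β * m))) := by
        calc _ ≤ Real.exp (-(p / 2)) ^ #(B j) :=
              pow_le_pow_left₀ (by nlinarith [Real.exp_pos (-1)]) h1 _
          _ = Real.exp (-(p / 2 * #(B j))) := by rw [← Real.exp_nat_mul]; congr 1; ring
          _ ≤ _ := Real.exp_le_exp.2 (neg_le_neg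
            (mul_le_mul_of_nonneg_left (hB j) (by positivity)))
      calc _ ≤ Real.exp (p * β / 4 * m) * Real.exp (-(p / 2 * (β * m))) := by gcongr
        _ = Real.exp (-(p * β / 4 * m)) := by rw [← Real.exp_add]; congr 1; ring
        _ ≤ _ := hexpc _ (min_le_right _ _)
    linarith
  have hfin : (1 : ℝ) ≤ m * (2 * Real.exp (-(c * m))) := by
    calc (1 : ℝ) = ∑ T ∈ V.powerset, w T * 1 := by simp [hw1]
      _ ≤ ∑ T ∈ V.powerset, w T * ∑ j, g j T :=
        sum_le_sum fun T _ => mul_le_mul_of_nonneg_left (hg T) (hw0 T)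
      _ = ∑ j, ∑ T ∈ V.powerset, w T * g j T := by
        simp only [mul_sum]; exact sum_comm
      _ ≤ ∑ _j : J, 2 * Real.exp (-(c * m)) := sum_le_sum fun j _ => hj j
      _ = Fintype.card J * (2 * Real.exp (-(c * m))) := by simp
      _ ≤ _ := by gcongr
  exact absurd (hN m hm) (not_lt.2 hfin)

/-! ### Maximum rainbow matchings and alternating paths -/

/-- A rainbow matching in a coloured bipartite multigraph, whose edges of colour `k` are the pairs
in `E k`. It covers the vertices `y ∈ S`; such a vertex is matched to `p y` in the colour `col y`. -/
structure IsRainbowAssignment {X Y κ : Type*} (E : κ → Finset (X × Y)) (S : Finset Y)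
    (p : Y → X) (col : Y → κ) : Prop where
  mem : ∀ y ∈ S, (p y, y) ∈ E (col y)
  injOn : Set.InjOn p S
  colInjOn : Set.InjOn col S

namespace IsRainbowAssignment

open Finset

variable {X Y κ : Type*} [DecidableEq Y] {E : κ → Finset (X × Y)} {S : Finset Y} {p : Y → X}
  {col : Y → κ}

/-- Serves both to augment (`y ∉ S`) and to rematch a covered vertex (`y ∈ S`), which frees its old
partner. -/
lemma update (h : IsRainbowAssignment E S p col) {x : X} {y : Y} {c : κ} (hxy : (x, y) ∈ E c)
    (hx : ∀ z ∈ S, p z ≠ x) (hc : ∀ z ∈ S, col z ≠ c) :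
    IsRainbowAssignment E (insert y S) (Function.update p y x) (Function.update col y c) where
  mem z hz := by
    rcases eq_or_ne z y with rfl | hzy
    · simpa using hxy
    · simpa [hzy] using h.mem z (mem_of_mem_insert_of_ne hz hzy)
  injOn := by
    intro z hz z' hz' he
    rcases eq_or_ne z y with hzy | hzy <;> rcases eq_or_ne z' y with hzy' | hzy'
    · exact hzy.trans hzy'.symm
    · simp only [hzy, Function.update_self, Function.update_of_ne hzy'] at he
      exact absurd he.symm (hx z' (mem_of_mem_insert_of_ne hz' hzy'))
    · simp only [hzy', Function.update_self, Function.update_of_ne hzy] at he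
      exact absurd he (hx z (mem_of_mem_insert_of_ne hz hzy))
    · simp only [Function.update_of_ne hzy', Function.update_of_ne hzy] at he
      exact h.injOn (mem_of_mem_insert_of_ne hz hzy) (mem_of_mem_insert_of_ne hz' hzy') he
  colInjOn := by
    intro z hz z' hz' he
    rcases eq_or_ne z y with hzy | hzy <;> rcases eq_or_ne z' y with hzy' | hzy'
    · exact hzy.trans hzy'.symm
    · simp only [hzy, Function.update_self, Function.update_of_ne hzy'] at he
      exact absurd he.symm (hc z' (mem_of_mem_insert_of_ne hz' hzy'))
    · simp only [hzy', Function.update_self, Function.update_of_ne hzy] at he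
      exact absurd he (hc z (mem_of_mem_insert_of_ne hz hzy))
    · simp only [Function.update_of_ne hzy', Function.update_of_ne hzy] at he
      exact h.colInjOn (mem_of_mem_insert_of_ne hz hzy) (mem_of_mem_insert_of_ne hz' hzy') he

/-- Alternating paths from the uncovered vertices that use each unused colour of `U` at most once
reach a set `B` of at least `#U * d` covered vertices. -/
lemma exists_reachable [DecidableEq X] [DecidableEq κ] (h : IsRainbowAssignment E S p col)
    (hmax : ∀ S' p' col', IsRainbowAssignment E S' p' col' → #S' ≤ #S)
    (hE : ∀ k, Set.InjOn Prod.fst (E k : Set (X × Y)))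
    (hE' : ∀ k, Set.InjOn Prod.snd (E k : Set (X × Y)))
    {d : ℝ} (hd : ∀ k, #S + d ≤ #(E k)) (U : Finset κ) (hU : Disjoint U (S.image col)) :
    ∃ B ⊆ S, #U * d ≤ #B ∧ ∀ x ∉ (S \ B).image p, ∃ p' col', IsRainbowAssignment E S p' col' ∧
      S.image col' ⊆ S.image col ∪ U ∧ x ∉ S.image p' ∧ ∀ y ∈ S \ B, p' y = p y := by
  -- Invariant: any `x` not matched by `p` into `S \ B` can be left free by rearranging only the
  -- edges at `B`, with extra colours from `U`.
  induction U using Finset.induction_on with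
  | empty =>
    exact ⟨∅, empty_subset _, by simp, fun x hx =>
      ⟨p, col, h, subset_union_left, by simpa using hx, fun _ _ => rfl⟩⟩
  | insert c U hcU ih =>
    rw [disjoint_insert_left] at hU
    obtain ⟨B, hBS, hBd, hB⟩ := ih hU.2
    have hfresh : ∀ col' : Y → κ, S.image col' ⊆ S.image col ∪ U → ∀ z ∈ S, col' z ≠ c := by
      rintro col' hcol' z hz rfl
      rcases mem_union.1 (hcol' (mem_image_of_mem _ hz)) with h1 | h1
      · exact hU.1 h1
      · exact hcU h1
    -- Edges of the new colour whose first end can be freed. Their second ends lie in `S`, or adding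
    -- such an edge would contradict maximality.
    let F := (E c).filter fun e => e.1 ∉ (S \ B).image p
    have hFS : F.image Prod.snd ⊆ S := by
      intro y hy
      obtain ⟨⟨x, y'⟩, he, rfl⟩ := mem_image.1 hy
      obtain ⟨he, hx⟩ := mem_filter.1 he
      by_contra hyS
      obtain ⟨p', col', h', hcol', hx', -⟩ := hB x hx
      have := hmax _ _ _ (h'.update he (fun z hz hzx => hx' (hzx ▸ mem_image_of_mem _ hz))
        (hfresh col' hcol'))
      rw [card_insert_of_notMem hyS] at this
      omega
    -- A colour class is a matching, so each vertex of `p (S \ B)` excludes at most one edge; hence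
    -- `#F ≥ #B + d`.
    have hFcard : #(E c) ≤ #F + #(S \ B) := by
      have h1 : #((E c).filter fun e => ¬ e.1 ∉ (S \ B).image p) ≤ #(S \ B) := by
        rw [← card_image_of_injOn ((hE c).mono (coe_subset.2 (filter_subset _ _)))]
        refine (card_le_card ?_).trans (card_image_le (s := S \ B) (f := p))
        intro x hx
        obtain ⟨e, he, rfl⟩ := mem_image.1 hx
        exact not_not.1 (mem_filter.1 he).2
      have h2 := card_filter_add_card_filter_not (s := E c) (fun e => e.1 ∉ (S \ B).image p)
      simp only [F]
      omega
    refine ⟨B ∪ F.image Prod.snd, union_subset hBS hFS, ?_, ?_⟩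
    · have h1 : #F ≤ #(B ∪ F.image Prod.snd) := by
        rw [← card_image_of_injOn ((hE' c).mono (coe_subset.2 (filter_subset _ _)))]
        exact card_le_card subset_union_right
      have h2 := card_sdiff_add_card_eq_card hBS
      have h3 := hd c
      have h1' : (#F : ℝ) ≤ #(B ∪ F.image Prod.snd) := by exact_mod_cast h1
      have h2' : (#(S \ B) : ℝ) + #B = #S := by exact_mod_cast h2
      have h4 : (#(E c) : ℝ) ≤ #F + #(S \ B) := by exact_mod_cast hFcard
      rw [card_insert_of_notMem hcU]
      push_cast
      linarith
    · intro x hx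
      have hsub : S.image col ∪ U ⊆ S.image col ∪ insert c U :=
        union_subset_union_right (subset_insert _ _)
      by_cases hxB : x ∈ (S \ B).image p
      · obtain ⟨y, hy, rfl⟩ := mem_image.1 hxB
        have hyS : y ∈ S := (mem_sdiff.1 hy).1
        have hyF : y ∈ F.image Prod.snd := by
          by_contra hyF
          refine hx (mem_image_of_mem _ (mem_sdiff.2 ⟨hyS, ?_⟩))
          rw [mem_union, not_or]
          exact ⟨(mem_sdiff.1 hy).2, hyF⟩
        -- To free `x = p y'`, first free `x₀`; this leaves `y'` matched to `x`, since `y' ∉ B`.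
        -- Then move `y'` to `x₀` in colour `c`.
        obtain ⟨⟨x₀, y'⟩, he, rfl⟩ := mem_image.1 hyF
        obtain ⟨he, hx₀⟩ := mem_filter.1 he
        obtain ⟨p', col', h', hcol', hx₀', hpp⟩ := hB x₀ hx₀
        simp only at hy hyS he hx₀ hx₀' hxB hx ⊢
        have h'' := h'.update he (fun z hz hzx => hx₀' (hzx ▸ mem_image_of_mem _ hz))
          (hfresh col' hcol')
        rw [insert_eq_of_mem hyS] at h''
        refine ⟨_, _, h'', ?_, ?_, ?_⟩
        · intro k hk
          obtain ⟨z, hz, rfl⟩ := mem_image.1 hk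
          rcases eq_or_ne z y' with rfl | hzy
          · simp
          · rw [Function.update_of_ne hzy]
            exact hsub (hcol' (mem_image_of_mem _ hz))
        · intro hmem
          obtain ⟨z, hz, hzp⟩ := mem_image.1 hmem
          rw [← hpp y' hy] at hzp
          rcases eq_or_ne z y' with rfl | hzy
          · rw [Function.update_self] at hzp
            exact hx₀' (hzp ▸ mem_image_of_mem _ hyS)
          · rw [Function.update_of_ne hzy] at hzp
            exact hzy (h'.injOn hz hyS hzp)
        · intro z hz
          have hz' := mem_sdiff.1 hz
          rw [mem_union, not_or] at hz'
          have hzy : z ≠ y' := by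
            rintro rfl
            exact hz'.2.2 hyF
          rw [Function.update_of_ne hzy]
          exact hpp z (mem_sdiff.2 ⟨hz'.1, hz'.2.1⟩)
      · obtain ⟨p', col', h', hcol', hx', hpp⟩ := hB x hxB
        exact ⟨p', col', h', hcol'.trans hsub, hx', fun z hz =>
          hpp z (sdiff_subset_sdiff Subset.rfl subset_union_left hz)⟩

end IsRainbowAssignment

open Finset in
/-- If all of the `n` colour classes have at least `n + d` edges, then some rainbow matching misses
at most `n / d` colours. -/
lemma exists_large_rainbow_matching {X Y κ : Type*} [Nonempty (X × Y)] [Fintype κ] [DecidableEq κ]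
    (E : κ → Finset (X × Y)) (hE : ∀ k, Set.InjOn Prod.fst (E k : Set (X × Y)))
    (hE' : ∀ k, Set.InjOn Prod.snd (E k : Set (X × Y))) {d : ℝ}
    (hd : ∀ k, Fintype.card κ + d ≤ #(E k)) :
    ∃ (R : Finset κ) (φ : κ → X × Y), #R * d ≤ Fintype.card κ ∧ (∀ k ∉ R, φ k ∈ E k) ∧
      Set.InjOn (fun k => (φ k).1) {k | k ∉ R} ∧ Set.InjOn (fun k => (φ k).2) {k | k ∉ R} := by
  classical
  rcases isEmpty_or_nonempty κ with hκ | ⟨⟨k₀⟩⟩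
  · exact ⟨∅, fun k => isEmptyElim k, by simp, fun k => isEmptyElim k,
      fun k => isEmptyElim k, fun k => isEmptyElim k⟩
  obtain ⟨⟨x₀, y₀⟩⟩ : Nonempty (X × Y) := inferInstance
  have : Nonempty Y := ⟨y₀⟩
  have hle : ∀ S p col, IsRainbowAssignment E S p col → #S ≤ Fintype.card κ := by
    intro S p col h
    rw [← card_image_of_injOn h.colInjOn]
    exact card_le_univ _
  have hex : ∃ t S p col, IsRainbowAssignment E S p col ∧ #S = t :=
    ⟨0, ∅, fun _ => x₀, fun _ => k₀, ⟨by simp, by simp, by simp⟩, rfl⟩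
  obtain ⟨S, p, col, h, hmax⟩ : ∃ S p col, IsRainbowAssignment E S p col ∧
      ∀ S' p' col', IsRainbowAssignment E S' p' col' → #S' ≤ #S := by
    have hb : ∀ t, (∃ S p col, IsRainbowAssignment E S p col ∧ #S = t) → t ≤ Fintype.card κ := by
      rintro t ⟨S, p, col, h, rfl⟩
      exact hle S p col h
    obtain ⟨t₀, ht₀⟩ := hex
    obtain ⟨S, p, col, h, hS⟩ := Nat.findGreatest_spec
      (P := fun t => ∃ S p col, IsRainbowAssignment E S p col ∧ #S = t) (hb t₀ ht₀) ht₀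
    exact ⟨S, p, col, h, fun S' p' col' h' => hS ▸
      Nat.le_findGreatest (hb _ ⟨S', p', col', h', rfl⟩) ⟨S', p', col', h', rfl⟩⟩
  have hd' : ∀ k, #S + d ≤ #(E k) := fun k => by
    have : (#S : ℝ) ≤ Fintype.card κ := by exact_mod_cast hle _ _ _ h
    linarith [hd k]
  -- With `U` the set of all missing colours, `#U * d ≤ #B ≤ #S ≤ n`.
  obtain ⟨B, hBS, hBd, -⟩ := h.exists_reachable hmax hE hE' hd' (univ \ S.image col)
    sdiff_disjoint
  have hy : ∀ k ∉ univ \ S.image col, ∃ y ∈ S, col y = k := by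
    intro k hk
    simpa using hk
  choose! y hyS hyc using hy
  refine ⟨univ \ S.image col, fun k => (p (y k), y k), ?_, ?_, ?_, ?_⟩
  · refine hBd.trans ?_
    exact_mod_cast (card_le_card hBS).trans (hle _ _ _ h)
  · intro k hk
    have := h.mem _ (hyS k hk)
    rwa [hyc k hk] at this
  · intro k hk k' hk' he
    rw [← hyc k hk, ← hyc k' hk', h.injOn (hyS k hk) (hyS k' hk') he]
  · intro k hk k' hk' he
    rw [← hyc k hk, ← hyc k' hk']
    exact congrArg col he

/-! ### Greedy choice for the few remaining colours -/

-- Each edge already chosen blocks at most two edges of any other colour, one at each end, so fewer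
-- than `2 * #R` edges are blocked at every step.
open Finset in
lemma exists_rainbow_matching_of_two_mul_card_le {X Y κ : Type*} [Nonempty (X × Y)] [DecidableEq κ]
    (E : κ → Finset (X × Y)) (hE : ∀ k, Set.InjOn Prod.fst (E k : Set (X × Y)))
    (hE' : ∀ k, Set.InjOn Prod.snd (E k : Set (X × Y))) (R : Finset κ)
    (hR : ∀ k ∈ R, 2 * #R ≤ #(E k)) :
    ∃ φ : κ → X × Y, (∀ k ∈ R, φ k ∈ E k) ∧
      Set.InjOn (fun k => (φ k).1) R ∧ Set.InjOn (fun k => (φ k).2) R := by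
  classical
  induction R using Finset.induction_on with
  | empty => exact ⟨fun _ => Classical.arbitrary _, by simp, by simp, by simp⟩
  | insert c R hc ih =>
    rw [card_insert_of_notMem hc] at hR
    obtain ⟨φ, hφ, h1, h2⟩ := ih fun k hk => (hR k (mem_insert_of_mem hk)).trans' (by omega)
    have hcard := hR c (mem_insert_self _ _)
    obtain ⟨e, he, he1, he2⟩ : ∃ e ∈ E c, e.1 ∉ R.image (fun k => (φ k).1) ∧
        e.2 ∉ R.image (fun k => (φ k).2) := by
      by_contra! hno
      have hsub : E c ⊆ (E c).filter (fun e => e.1 ∈ R.image (fun k => (φ k).1)) ∪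
          (E c).filter (fun e => e.2 ∈ R.image (fun k => (φ k).2)) := by
        intro e he
        by_cases hh : e.1 ∈ R.image (fun k => (φ k).1)
        · exact mem_union_left _ (mem_filter.2 ⟨he, hh⟩)
        · exact mem_union_right _ (mem_filter.2 ⟨he, hno e he hh⟩)
      have b1 : #((E c).filter (fun e => e.1 ∈ R.image (fun k => (φ k).1))) ≤ #R :=
        (card_le_card_of_injOn Prod.fst (fun e he => (mem_filter.1 he).2)
          ((hE c).mono (coe_subset.2 (filter_subset _ _)))).trans card_image_le
      have b2 : #((E c).filter (fun e => e.2 ∈ R.image (fun k => (φ k).2))) ≤ #R :=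
        (card_le_card_of_injOn Prod.snd (fun e he => (mem_filter.1 he).2)
          ((hE' c).mono (coe_subset.2 (filter_subset _ _)))).trans card_image_le
      have := (card_le_card hsub).trans (card_union_le _ _)
      omega
    have hne : ∀ k ∈ R, k ≠ c := fun k hk hkc => hc (hkc ▸ hk)
    refine ⟨Function.update φ c e, ?_, ?_, ?_⟩
    · intro k hk
      rcases mem_insert.1 hk with rfl | hk
      · simpa using he
      · rw [Function.update_of_ne (hne k hk)]
        exact hφ k hk
    · rw [coe_insert, Set.injOn_insert (by simpa using hc)]
      refine ⟨fun k hk k' hk' hh => h1 hk hk' ?_, ?_⟩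
      · simpa [Function.update_of_ne (hne k hk), Function.update_of_ne (hne k' hk')] using hh
      · rintro ⟨k, hk, hh⟩
        simp only [Function.update_self, Function.update_of_ne (hne k hk)] at hh
        exact he1 (hh ▸ mem_image_of_mem (fun k => (φ k).1) hk)
    · rw [coe_insert, Set.injOn_insert (by simpa using hc)]
      refine ⟨fun k hk k' hk' hh => h2 hk hk' ?_, ?_⟩
      · simpa [Function.update_of_ne (hne k hk), Function.update_of_ne (hne k' hk')] using hh
      · rintro ⟨k, hk, hh⟩
        simp only [Function.update_self, Function.update_of_ne (hne k hk)] at hh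
        exact he2 (hh ▸ mem_image_of_mem (fun k => (φ k).2) hk)

/-! ### Combining the reserve with the large matching -/

open Finset in
/-- A family of `n` matchings of a common size `m ≥ (1 + ε) * n` between `X` and `Y` has a system of
pairwise disjoint representatives. -/
lemma exists_full_rainbow_matching {ε : ℝ} (hε : 0 < ε) :
    ∃ N : ℕ, ∀ (X Y κ : Type*) [Fintype κ] (E : κ → Finset (X × Y)) (m : ℕ),
      (∀ k, Set.InjOn Prod.fst (E k : Set (X × Y))) →
      (∀ k, Set.InjOn Prod.snd (E k : Set (X × Y))) → N ≤ Fintype.card κ →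
      (1 + ε) * Fintype.card κ ≤ m → (∀ k, #(E k) = m) →
      ∃ φ : κ → X × Y, (∀ k, φ k ∈ E k) ∧
        Function.Injective (fun k => (φ k).1) ∧ Function.Injective (fun k => (φ k).2) := by
  -- Chosen so that losing `2 * δ * m` edges per colour leaves `(1 + ε / 2) * n`.
  set δ : ℝ := ε / (4 * (1 + ε)) with hδ
  have hδ0 : 0 < δ := by positivity
  have hδ1 : δ ≤ 1 := by
    rw [hδ, div_le_one (by positivity)]; linarith
  have hδm : (1 - 2 * δ) * (1 + ε) = 1 + ε / 2 := by
    rw [hδ]; field_simp; ring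
  obtain ⟨γ, hγ, N₁, hN₁⟩ := Finset.exists_sparse_sample hδ0 hδ1 one_pos
  obtain ⟨γ', hγ', N₂, hN₂⟩ := Finset.exists_sparse_sample hδ0 hδ1 hγ
  -- The last bound makes `γ' * m ≥ 4 / ε`, twice the maximal number `2 / ε` of missing colours.
  refine ⟨max (max N₁ N₂) (max 1 ⌈4 / ε / γ'⌉₊), fun X Y κ _ E m hE hE' hn hm hcard => ?_⟩
  classical
  obtain ⟨⟨hn1, hn2⟩, hn0, hn3⟩ := by simpa only [max_le_iff] using hn
  set n := Fintype.card κ with hn_def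
  have hn0' : (1 : ℝ) ≤ n := by exact_mod_cast hn0
  have hnm : n ≤ m := by
    have : (n : ℝ) ≤ m := by nlinarith
    exact_mod_cast this
  have himg : ∀ k, #((E k).image Prod.fst) = m := fun k => by
    rw [card_image_of_injOn (hE k), hcard]
  have himg' : ∀ k, #((E k).image Prod.snd) = m := fun k => by
    rw [card_image_of_injOn (hE' k), hcard]
  obtain ⟨P, hP⟩ := hN₁ m (hn1.trans hnm) X κ (fun k => (E k).image Prod.fst)
    (fun k => (E k).image Prod.fst) hnm (fun k => (himg k).le) (fun k => by simp [himg k])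
  have hPcard : ∀ k, #((E k).filter fun e => e.1 ∈ P) = #((E k).image Prod.fst ∩ P) := by
    intro k
    rw [← card_image_of_injOn ((hE k).mono (coe_subset.2 (filter_subset _ _)))]
    congr 1
    ext x
    simp only [mem_image, mem_filter, mem_inter]
    constructor
    · rintro ⟨e, ⟨he, hx⟩, rfl⟩
      exact ⟨⟨e, he, rfl⟩, hx⟩
    · rintro ⟨⟨e, he, rfl⟩, hx⟩
      exact ⟨e, ⟨he, hx⟩, rfl⟩
  -- `Q` is sampled with `P` already fixed: the edges of a colour starting in `P` have distinct
  -- second ends, and linearly many of these must fall in `Q`.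
  obtain ⟨Q, hQ⟩ := hN₂ m (hn2.trans hnm) Y κ (fun k => (E k).image Prod.snd)
    (fun k => ((E k).filter fun e => e.1 ∈ P).image Prod.snd) hnm (fun k => (himg' k).le)
    (fun k => by
      rw [card_image_of_injOn ((hE' k).mono (coe_subset.2 (filter_subset _ _))), hPcard]
      exact (hP k).2)
  have hQcard : ∀ k, ∀ F ⊆ E k, #(F.filter fun e => e.2 ∈ Q) = #(F.image Prod.snd ∩ Q) := by
    intro k F hF
    rw [← card_image_of_injOn ((hE' k).mono (coe_subset.2 ((filter_subset _ _).trans hF)))]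
    congr 1
    ext x
    simp only [mem_image, mem_filter, mem_inter]
    constructor
    · rintro ⟨e, ⟨he, hx⟩, rfl⟩
      exact ⟨⟨e, he, rfl⟩, hx⟩
    · rintro ⟨⟨e, he, rfl⟩, hx⟩
      exact ⟨e, ⟨he, hx⟩, rfl⟩
  -- No edge of any `I k` meets an edge of any `O l`, so matchings found in the two families can be
  -- united.
  let I : κ → Finset (X × Y) := fun k => ((E k).filter fun e => e.1 ∈ P).filter fun e => e.2 ∈ Q
  let O : κ → Finset (X × Y) := fun k => (E k).filter fun e => e.1 ∉ P ∧ e.2 ∉ Q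
  have hIE : ∀ k, I k ⊆ E k := fun k => (filter_subset _ _).trans (filter_subset _ _)
  have hOE : ∀ k, O k ⊆ E k := fun k => filter_subset _ _
  have hI : ∀ k, γ' * m ≤ #(I k) := by
    intro k
    simp only [I]
    rw [hQcard k _ (filter_subset _ _)]
    exact (hQ k).2
  have hO : ∀ k, (n : ℝ) + ε / 2 * n ≤ #(O k) := by
    intro k
    have h1 : E k ⊆ O k ∪ ((E k).filter (fun e => e.1 ∈ P) ∪ (E k).filter fun e => e.2 ∈ Q) := by
      intro e he
      simp only [O, mem_union, mem_filter]
      tauto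
    have h2 := (card_le_card h1).trans ((card_union_le _ _).trans
      (Nat.add_le_add_left (card_union_le _ _) _))
    rw [hcard, hPcard, hQcard k _ Subset.rfl] at h2
    have h3 : (m : ℝ) ≤ #(O k) + (#((E k).image Prod.fst ∩ P) + #((E k).image Prod.snd ∩ Q)) := by
      exact_mod_cast h2
    have h4 := (hP k).1
    have h5 := (hQ k).1
    have h6 : (1 - 2 * δ) * ((1 + ε) * n) ≤ (1 - 2 * δ) * m := by
      refine mul_le_mul_of_nonneg_left hm ?_
      by_contra! hneg
      nlinarith
    have h7 : (1 - 2 * δ) * ((1 + ε) * n) = n + ε / 2 * n := by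
      rw [← mul_assoc, hδm]; ring
    linarith
  obtain ⟨k₀⟩ : Nonempty κ := Fintype.card_pos_iff.1 hn0
  obtain ⟨e₀, -⟩ : (E k₀).Nonempty := card_pos.1 (by rw [hcard]; omega)
  have : Nonempty (X × Y) := ⟨e₀⟩
  obtain ⟨R, φ, hR, hφ, hφ1, hφ2⟩ := exists_large_rainbow_matching O
    (fun k => (hE k).mono (coe_subset.2 (hOE k))) (fun k => (hE' k).mono (coe_subset.2 (hOE k))) hO
  have hRε : (#R : ℝ) * (ε / 2) ≤ 1 := by
    refine le_of_mul_le_mul_right (a := (n : ℝ)) ?_ (by linarith)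
    linarith
  have hRI : ∀ k ∈ R, 2 * #R ≤ #(I k) := by
    intro k _
    have h1 : (4 / ε / γ' : ℝ) ≤ m := (Nat.ceil_le.1 hn3).trans (by exact_mod_cast hnm)
    rw [div_le_iff₀ hγ', div_le_iff₀ hε] at h1
    have h2 : (2 * #R : ℝ) ≤ #(I k) := by
      refine le_trans ?_ (hI k)
      refine le_of_mul_le_mul_right (a := ε) ?_ hε
      linarith
    exact_mod_cast h2
  obtain ⟨ψ, hψ, hψ1, hψ2⟩ := exists_rainbow_matching_of_two_mul_card_le I
    (fun k => (hE k).mono (coe_subset.2 (hIE k))) (fun k => (hE' k).mono (coe_subset.2 (hIE k)))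
    R hRI
  have hψP : ∀ k ∈ R, (ψ k).1 ∈ P ∧ (ψ k).2 ∈ Q := fun k hk =>
    ⟨(mem_filter.1 (mem_filter.1 (hψ k hk)).1).2, (mem_filter.1 (hψ k hk)).2⟩
  have hφP : ∀ k ∉ R, (φ k).1 ∉ P ∧ (φ k).2 ∉ Q := fun k hk => (mem_filter.1 (hφ k hk)).2
  refine ⟨fun k => if k ∈ R then ψ k else φ k, fun k => ?_, fun k k' h => ?_, fun k k' h => ?_⟩
  · by_cases hk : k ∈ R
    · simpa [hk] using hIE k (hψ k hk)
    · simpa [hk] using hOE k (hφ k hk)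
  · by_cases hk : k ∈ R <;> by_cases hk' : k' ∈ R <;> simp only [hk, hk', if_true, if_false] at h
    · exact hψ1 hk hk' h
    · exact absurd (h ▸ (hψP k hk).1) (hφP k' hk').1
    · exact absurd (h ▸ (hψP k' hk').1) (hφP k hk).1
    · exact hφ1 hk hk' h
  · by_cases hk : k ∈ R <;> by_cases hk' : k' ∈ R <;> simp only [hk, hk', if_true, if_false] at h
    · exact hψ2 hk hk' h
    · exact absurd (h ▸ (hψP k hk).2) (hφP k' hk').2
    · exact absurd (h ▸ (hψP k' hk').2) (hφP k hk).2
    · exact hφ2 hk hk' h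

/-! ### From multigraphs to families of vertex pairs -/

theorem theorem1p3 (ε : ℝ) (hε : 0 < ε) :
    ∃ N₀ : ℕ, ∀ (α : Type*) (β : Type*) (κ : Type*) [Fintype κ] (G : Graph α β) (c : E(G) → κ),
      G.IsBipartiteMultigraph →
      G.IsProperEdgeColouring c →
      N₀ ≤ Fintype.card κ →
      (∀ k : κ, (⌈(1 + ε) * (Fintype.card κ : ℝ)⌉₊ : ℕ∞) ≤ {e : E(G) | c e = k}.encard) →
      ∃ M : Set E(G), G.IsRainbowMatching c M ∧ ∀ k : κ, ∃ e ∈ M, c e = k := by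
  obtain ⟨N, hN⟩ := exists_full_rainbow_matching hε
  refine ⟨N, fun α β κ _ G c hG hc hn hcard => ?_⟩
  classical
  obtain ⟨X, Y, hXY, -, hlink⟩ := hG
  have hends : ∀ e : E(G), ∃ q : α × α, G.IsLink e q.1 q.2 ∧ q.1 ∈ X ∧ q.2 ∈ Y := by
    rintro ⟨e, he⟩
    obtain ⟨x, y, hxy⟩ := Graph.exists_isLink_of_mem_edgeSet he
    rcases hlink e x y hxy with h | h
    · exact ⟨(x, y), hxy, h⟩
    · exact ⟨(y, x), hxy.symm, h.2, h.1⟩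
  choose q hq hqX hqY using hends
  -- Properness makes parallel edges differ in colour, so replacing edges by pairs of ends loses
  -- nothing within a colour.
  have hmeet : ∀ e f : E(G), (q e).1 = (q f).1 ∨ (q e).2 = (q f).2 → c e = c f → e = f := by
    intro e f h hcol
    by_contra hne
    refine hc e f hne ?_ hcol
    rcases h with h | h
    · exact ⟨(q e).1, (hq e).inc_left, h ▸ (hq f).inc_left⟩
    · exact ⟨(q e).2, (hq e).inc_right, h ▸ (hq f).inc_right⟩
  have hinc : ∀ (e : E(G)) v, G.Inc e v → v = (q e).1 ∨ v = (q e).2 := fun e v hv =>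
    hv.eq_or_eq_of_isLink (hq e)
  set m := ⌈(1 + ε) * (Fintype.card κ : ℝ)⌉₊ with hm
  -- Classes may be huge or infinite, while the sampling needs sizes bounded by a common `m`.
  have hclass : ∀ k, ∃ F : Finset E(G), (∀ e ∈ F, c e = k) ∧ F.card = m := by
    intro k
    obtain ⟨t, ht, htm⟩ := Set.exists_subset_encard_eq (hcard k)
    have hfin : t.Finite := Set.finite_of_encard_eq_coe htm
    refine ⟨hfin.toFinset, fun e he => ht (hfin.mem_toFinset.1 he), ?_⟩
    rw [hfin.encard_eq_coe_toFinset_card] at htm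
    exact_mod_cast htm
  choose F hFc hFm using hclass
  obtain ⟨φ, hφ, hφ1, hφ2⟩ := hN α α κ (fun k => (F k).image q) m
    (by
      rintro k _ h _ h' he
      obtain ⟨e, heF, rfl⟩ := Finset.mem_image.1 h
      obtain ⟨f, hfF, rfl⟩ := Finset.mem_image.1 h'
      rw [hmeet e f (Or.inl he) ((hFc k e heF).trans (hFc k f hfF).symm)])
    (by
      rintro k _ h _ h' he
      obtain ⟨e, heF, rfl⟩ := Finset.mem_image.1 h
      obtain ⟨f, hfF, rfl⟩ := Finset.mem_image.1 h'
      rw [hmeet e f (Or.inr he) ((hFc k e heF).trans (hFc k f hfF).symm)])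
    hn (Nat.le_ceil _)
    (fun k => by
      rw [Finset.card_image_of_injOn, hFm]
      intro e he f hf h
      exact hmeet e f (Or.inl (congrArg Prod.fst h)) ((hFc k e he).trans (hFc k f hf).symm))
  have hpre : ∀ k, ∃ e ∈ F k, q e = φ k := fun k => Finset.mem_image.1 (hφ k)
  choose e heF heφ using hpre
  have hec : ∀ k, c (e k) = k := fun k => hFc k _ (heF k)
  refine ⟨Set.range e, ⟨?_, ?_⟩, fun k => ⟨e k, ⟨k, rfl⟩, hec k⟩⟩
  · rintro _ ⟨k, rfl⟩ _ ⟨l, rfl⟩ hne ⟨v, hv, hv'⟩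
    have hkl : k ≠ l := fun h => hne (h ▸ rfl)
    -- Both sides were taken to be the whole type `α`, so a first end meeting a second end must be
    -- excluded through `X ∩ Y = ∅`.
    have hcross : ∀ i j, (q (e i)).1 ≠ (q (e j)).2 := fun i j h =>
      Set.disjoint_left.1 hXY (hqX (e i)) (h ▸ hqY (e j))
    rcases hinc _ _ hv with h | h <;> rcases hinc _ _ hv' with h' | h' <;> rw [h] at h'
    · rw [heφ, heφ] at h'
      exact hkl (hφ1 h')
    · exact hcross _ _ h'
    · exact hcross _ _ h'.symm
    · rw [heφ, heφ] at h'
      exact hkl (hφ2 h')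
  · rintro _ ⟨k, rfl⟩ _ ⟨l, rfl⟩ h
    rw [hec, hec] at h
    rw [h]
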